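/- A regulator contracts with a data-rich monopolist. Consumers have values $\theta\in[\underline\theta,\overline\theta]$ distributed according to an atomless probability measure $G$; the monopolist has a private cost type $t\in[\underline t,\overline t]$, $\underline t<\overline t$, distributed according to a probability measure $F$, independently of $\theta$. Serving consumer $\theta$ costs type $t$ the amount $c(\theta,t)$, where $c$ is measurable and bounded, continuously differentiable in $t$ with $\partial_t c$ uniformly bounded, and strictly decreasing in $t$; the total surplus $S(\theta,t):=\theta-c(\theta,t)$ is non-negative. Let $r$ be a randomization device (a random element of an arbitrary probability space), independent of $(\theta,t)$. A pricing rule is a measurable function $p(\theta,r)\in\mathbb R$ with $\mathbb E_{\theta,r}[(\theta-p(\theta,r))_+]<\infty$. It gives type $t$ the profit $\Pi(p,t)=\mathbb E_{\theta,r}\big[(p(\theta,r)-c(\theta,t))\mathbf 1_{\theta\ge p(\theta,r)}\big]$ and consumer $\theta$ the surplus $\mathrm{CS}(p,\theta)=\mathbb E_r[(\theta-p(\theta,r))_+]$. A mechanism assigns to each type $t$, measurably in $t$, a pricing rule $p(t)=p(\cdot,\cdot\,;t)$ and a tax $T(t)\in\mathbb R$ such that, for all $t,\hat t\in[\underline t,\overline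 t]$, $$\Pi(p(t),t)-T(t)\ \ge\ \Pi(p(\hat t),t)-T(\hat t)\qquad\text{and}\qquad \Pi(p(t),t)-T(t)\ \ge\ 0 .$$ For a given $\alpha\in[0,1]$, a mechanism is optimal if it maximizes, among all mechanisms, the regulator's objective $$\mathbb E_t\big[\mathbb E_\theta[\mathrm{CS}(p(t),\theta)]+T(t)\big]+\alpha\,\mathbb E_t\big[\Pi(p(t),t)-T(t)\big].$$ A mechanism is a uniform pricing regulation if, for every $t$, the price $p(\theta,r;t)$ depends neither on $\theta$ nor on $r$. It is a discriminatory pricing regulation if, for every $t$, the price $p(\theta,r;t)$ does not depend on $r$ and $p(\theta,r;t)\in\{\theta,\overline\theta+1\}$ for every $\theta$. (1) If $S$ is log-submodular, i.e. $S(\theta,t)S(\theta',t')\le S(\theta,t')S(\theta',t)$ for all $\theta\le\theta'$ and $t\le t'$, then there is an optimal mechanism that is a uniform pricing regulation. (2) If $S$ is log-supermodular, i.e. $S(\theta,t)S(\theta',t')\ge S(\theta,t')S(\theta',t)$ for all $\theta\le\theta'$ and $t\le t'$, then there is an optimal mechanism that is a discriminatory pricing regulation. -/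

import Mathlib

open MeasureTheory Set

namespace Regulation

/-- The total surplus `S(θ, t) = θ - c(θ, t)` from serving consumer value `θ` when the
monopolist's cost type is `t`. -/
def totalSurplus (c : ℝ → ℝ → ℝ) (θ t : ℝ) : ℝ := θ - c θ t

/-- Log-submodularity on `A × B` of a non-negative function, in the product form that also makes
sense where the function vanishes (with `log 0 = -∞`). -/
def LogSubmodularOn (S : ℝ → ℝ → ℝ) (A B : Set ℝ) : Prop :=
  ∀ θ₁ ∈ A, ∀ θ₂ ∈ A, ∀ t₁ ∈ B, ∀ t₂ ∈ B, θ₁ ≤ θ₂ → t₁ ≤ t₂ →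
    S θ₁ t₁ * S θ₂ t₂ ≤ S θ₁ t₂ * S θ₂ t₁

/-- Log-supermodularity on `A × B` of a non-negative function, in product form. -/
def LogSupermodularOn (S : ℝ → ℝ → ℝ) (A B : Set ℝ) : Prop :=
  ∀ θ₁ ∈ A, ∀ θ₂ ∈ A, ∀ t₁ ∈ B, ∀ t₂ ∈ B, θ₁ ≤ θ₂ → t₁ ≤ t₂ →
    S θ₁ t₂ * S θ₂ t₁ ≤ S θ₁ t₁ * S θ₂ t₂

section

variable {R : Type*} [MeasurableSpace R]

/-- The expected surplus `E_r[(θ - p(θ, r))₊]` of consumer `θ` under the pricing rule `p`, where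
`ρ` is the law of the randomization device. -/
noncomputable def consumerSurplus (ρ : Measure R) (p : ℝ → R → ℝ) (θ : ℝ) : ℝ :=
  ∫ r, max (θ - p θ r) 0 ∂ρ

/-- The profit `E_{θ,r}[(p(θ, r) - c(θ, t)) 1{θ ≥ p(θ, r)}]` of cost type `t` under the pricing
rule `p`; the value `θ ∼ G` and the device `r ∼ ρ` are independent. -/
noncomputable def profit (G : Measure ℝ) (ρ : Measure R) (c : ℝ → ℝ → ℝ)
    (p : ℝ → R → ℝ) (t : ℝ) : ℝ :=
  ∫ z : ℝ × R, {z : ℝ × R | p z.1 z.2 ≤ z.1}.indicator (fun z => p z.1 z.2 - c z.1 t) z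
    ∂(G.prod ρ)

/-- A pricing rule `p(θ, r)`: a measurable posted price for each consumer value and each
realization of the randomization device, with finite expected consumer surplus. -/
structure IsPricingRule (G : Measure ℝ) (ρ : Measure R) (p : ℝ → R → ℝ) : Prop where
  measurable : Measurable (fun z : ℝ × R => p z.1 z.2)
  integrable : Integrable (fun z : ℝ × R => max (z.1 - p z.1 z.2) 0) (G.prod ρ)

/-- A direct mechanism: it assigns to each cost type `t ∈ [t₀, t₁]` the pricing rule
`p t` and the tax `T t` (a subsidy if negative), measurably in `t`, and satisfies the
monopolist's incentive compatibility and individual rationality constraints. -/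
structure IsMechanism (t₀ t₁ : ℝ) (G : Measure ℝ) (ρ : Measure R) (c : ℝ → ℝ → ℝ)
    (p : ℝ → ℝ → R → ℝ) (T : ℝ → ℝ) : Prop where
  measurable_price : Measurable (fun z : ℝ × ℝ × R => p z.1 z.2.1 z.2.2)
  measurable_tax : Measurable T
  pricingRule : ∀ t ∈ Icc t₀ t₁, IsPricingRule G ρ (p t)
  incentiveCompatible : ∀ t ∈ Icc t₀ t₁, ∀ s ∈ Icc t₀ t₁,
    profit G ρ c (p s) t - T s ≤ profit G ρ c (p t) t - T t
  individuallyRational : ∀ t ∈ Icc t₀ t₁, 0 ≤ profit G ρ c (p t) t - T t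

/-- The regulator's objective
`E[CS(p(t), θ) + T(t)] + α E[Π(p(t), t) - T(t)]`, where `t ∼ F` and `θ ∼ G` are independent. -/
noncomputable def objective (F G : Measure ℝ) (ρ : Measure R) (c : ℝ → ℝ → ℝ) (α : ℝ)
    (p : ℝ → ℝ → R → ℝ) (T : ℝ → ℝ) : ℝ :=
  (∫ t, ((∫ θ, consumerSurplus ρ (p t) θ ∂G) + T t) ∂F)
    + α * ∫ t, (profit G ρ c (p t) t - T t) ∂F

/-- The mechanism `(p, T)` is feasible and maximizes the regulator's objective among all
mechanisms. -/
def IsOptimal (t₀ t₁ : ℝ) (F G : Measure ℝ) (ρ : Measure R) (c : ℝ → ℝ → ℝ) (α : ℝ)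
    (p : ℝ → ℝ → R → ℝ) (T : ℝ → ℝ) : Prop :=
  IsMechanism t₀ t₁ G ρ c p T ∧
    ∀ (p' : ℝ → ℝ → R → ℝ) (T' : ℝ → ℝ), IsMechanism t₀ t₁ G ρ c p' T' →
      objective F G ρ c α p' T' ≤ objective F G ρ c α p T

/-- Uniform pricing: the price assigned to each cost type depends neither on the consumer's value
nor on the randomization device. -/
def IsUniformPricing (t₀ t₁ θ₀ θ₁ : ℝ) (p : ℝ → ℝ → R → ℝ) : Prop :=
  ∀ t ∈ Icc t₀ t₁, ∃ k : ℝ, ∀ θ ∈ Icc θ₀ θ₁, ∀ r, p t θ r = k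

/-- Discriminatory pricing: the pricing rule assigned to each cost type is deterministic and
charges each consumer either the full value `θ` or the price `θ₁ + 1`, at which nobody buys. -/
def IsDiscriminatoryPricing (t₀ t₁ θ₀ θ₁ : ℝ) (p : ℝ → ℝ → R → ℝ) : Prop :=
  ∀ t ∈ Icc t₀ t₁, ∃ q : ℝ → ℝ, ∀ θ ∈ Icc θ₀ θ₁,
    (q θ = θ ∨ q θ = θ₁ + 1) ∧ ∀ r, p t θ r = q θ

end

end Regulation

namespace Regulation

open Filter Topology

/-! Rank consumers by `X θ = -θ` in the log-submodular case and by `X θ = θ` in the log-supermodular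
case; in both, the surplus becomes log-supermodular in (rank, cost type). The claim is that it is
optimal to serve each type a lower set of this ranking: high values, hence one posted price, when `X
θ = -θ`; low values, hence full extraction from chosen consumers, when `X θ = θ`.

Consumer surplus does not depend on the cost type, so incentives depend on a pricing rule only
through its sale set, and the objective is surplus minus `1 - α` times the rent. Only the upward
constraints and non-negative rents are used for the upper bound. Replace each sale set by a lower
set of the ranking with the same surplus for its own type. Log-supermodularity says that higher
types then gain less from mimicry (`setIntegral_threshold_le`), so the upward constraints survive
with the old rents.

The resulting levels `k t` need not be monotone in `t`. Serving `ω` from the first type `τ ω` whose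
level reaches `X ω` only adds surplus, and chained upward constraints show that the old rents still
cover the rents of this cutoff mechanism (`rent_ge_of_finset`, `rent_ge`, `exists_dominating`).
After exchanging integrals, the payoff is an integral over consumers of `cutoffValue`, which can be
maximized consumer by consumer. Single crossing makes the least maximizer monotone in the ranking
(`exists_optimal_cutoff`), so prices of the desired form implement it, and `exists_tax` attains the
bound. -/

/-- A bounded, non-negative surplus family on a type space `Ω`, continuous and increasing in the
cost type, positive above the lowest cost type `t₀`, and log-supermodular with respect to the
ranking `X` of `Ω`. -/
structure IsSurplusFamily {Ω : Type*} [MeasurableSpace Ω] (X : Ω → ℝ) (S : Ω → ℝ → ℝ)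
    (t₀ M : ℝ) : Prop where
  measurable : Measurable (fun z : Ω × ℝ => S z.1 z.2)
  nonneg : ∀ ω t, 0 ≤ S ω t
  le : ∀ ω t, S ω t ≤ M
  continuous : ∀ ω, Continuous (S ω)
  monotone : ∀ ω, Monotone (S ω)
  pos : ∀ ω t, t₀ < t → 0 < S ω t
  cross : ∀ ω ω', X ω ≤ X ω' → ∀ s t, s ≤ t → S ω t * S ω' s ≤ S ω s * S ω' t

/-! ### Domination of arbitrary sale sets by cutoffs. -/

section Abstract

variable {Ω : Type*} [MeasurableSpace Ω] {X : Ω → ℝ} {S : Ω → ℝ → ℝ} {t₀ M : ℝ}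

lemma IsSurplusFamily.measurable_comp (h : IsSurplusFamily X S t₀ M) {σ : Ω → ℝ}
    (hσ : Measurable σ) : Measurable (fun ω => S ω (σ ω)) :=
  h.measurable.comp (measurable_id.prodMk hσ)

lemma IsSurplusFamily.integrable_comp (h : IsSurplusFamily X S t₀ M) (μ : Measure Ω)
    [IsFiniteMeasure μ] {σ : Ω → ℝ} (hσ : Measurable σ) :
    Integrable (fun ω => S ω (σ ω)) μ :=
  Integrable.of_bound (h.measurable_comp hσ).aestronglyMeasurable M
    (ae_of_all _ fun ω => by
      rw [Real.norm_eq_abs, abs_of_nonneg (h.nonneg _ _)]; exact h.le _ _)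

lemma IsSurplusFamily.integrable (h : IsSurplusFamily X S t₀ M) (μ : Measure Ω)
    [IsFiniteMeasure μ] (t : ℝ) : Integrable (fun ω => S ω t) μ :=
  h.integrable_comp μ measurable_const

/-- The integral of an integrable function over the sublevel sets of an atomless variable takes
the same value as over any given set; there is a least such level. -/
lemma exists_isLeast_threshold (μ : Measure Ω) {x₀ x₁ : ℝ} (hx : x₀ ≤ x₁)
    (hX : Measurable X) (hXI : ∀ᵐ ω ∂μ, X ω ∈ Icc x₀ x₁) (hX0 : ∀ x, ∀ᵐ ω ∂μ, X ω ≠ x)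
    {f : Ω → ℝ} (hf : Integrable f μ) (hf0 : ∀ ω, 0 ≤ f ω) (B : Set Ω) :
    ∃ k, IsLeast {x ∈ Icc x₀ x₁ | ∫ ω in {ω | X ω ≤ x}, f ω ∂μ = ∫ ω in B, f ω ∂μ} k := by
  have hms : ∀ x, MeasurableSet {ω | X ω ≤ x} := fun x => hX measurableSet_Iic
  have hcont : Continuous (fun x => ∫ ω in {ω | X ω ≤ x}, f ω ∂μ) := by
    simp_rw [← integral_indicator (hms _)]
    rw [continuous_iff_continuousAt]
    intro x
    refine continuousAt_of_dominated (bound := fun ω => ‖f ω‖)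
      (Eventually.of_forall fun y => (hf.indicator (hms y)).aestronglyMeasurable)
      (Eventually.of_forall fun y => ae_of_all _ fun ω => norm_indicator_le_norm_self _ _)
      hf.norm ?_
    filter_upwards [hX0 x] with ω hω
    rcases lt_or_gt_of_ne hω with hlt | hgt
    · have : (fun y => {ω | X ω ≤ y}.indicator f ω) =ᶠ[𝓝 x] fun _ => f ω := by
        filter_upwards [eventually_gt_nhds hlt] with y hy
        exact indicator_of_mem (s := {ω | X ω ≤ y}) (show X ω ≤ y from hy.le) f
      exact continuousAt_const.congr this.symm
    · have : (fun y => {ω | X ω ≤ y}.indicator f ω) =ᶠ[𝓝 x] fun _ => 0 := by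
        filter_upwards [eventually_lt_nhds hgt] with y hy
        exact indicator_of_notMem (s := {ω | X ω ≤ y})
          (fun hle : X ω ≤ y => absurd hle (not_le.2 hy)) f
      exact continuousAt_const.congr this.symm
  have h0 : ∫ ω in {ω | X ω ≤ x₀}, f ω ∂μ = 0 := by
    refine setIntegral_measure_zero f ?_
    rw [measure_eq_zero_iff_ae_notMem]
    filter_upwards [hXI, hX0 x₀] with ω h1 h2 h3
    exact h2 (le_antisymm h3 h1.1)
  have h1 : ∫ ω in {ω | X ω ≤ x₁}, f ω ∂μ = ∫ ω, f ω ∂μ := by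
    rw [← setIntegral_univ (μ := μ)]
    refine setIntegral_congr_set ?_
    filter_upwards [hXI] with ω h1
    exact propext ⟨fun _ => trivial, fun _ => h1.2⟩
  have hle : ∫ ω in B, f ω ∂μ ≤ ∫ ω, f ω ∂μ :=
    setIntegral_le_integral hf (ae_of_all _ hf0)
  have hge : 0 ≤ ∫ ω in B, f ω ∂μ := integral_nonneg hf0
  obtain ⟨x, hxI, hxe⟩ := intermediate_value_Icc hx hcont.continuousOn
    (show ∫ ω in B, f ω ∂μ ∈ Icc _ _ from ⟨by rw [h0]; exact hge, by rw [h1]; exact hle⟩)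
  have hcomp : IsCompact {x ∈ Icc x₀ x₁ |
      ∫ ω in {ω | X ω ≤ x}, f ω ∂μ = ∫ ω in B, f ω ∂μ} :=
    isCompact_Icc.inter_right (isClosed_eq hcont continuous_const)
  exact hcomp.exists_isLeast ⟨x, hxI, hxe⟩

/-- Moving the sale set to the lower end of the ranking, at an unchanged surplus for the cost
type `s`, lowers the surplus of every more efficient cost type. -/
lemma IsSurplusFamily.setIntegral_threshold_le (h : IsSurplusFamily X S t₀ M) (μ : Measure Ω)
    [IsProbabilityMeasure μ] {x₀ x₁ : ℝ}
    (hX : Measurable X) (hXI : ∀ᵐ ω ∂μ, X ω ∈ Icc x₀ x₁) (hX0 : ∀ x, ∀ᵐ ω ∂μ, X ω ≠ x)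
    {B : Set Ω} (hB : MeasurableSet B) {s t k : ℝ} (hst : s ≤ t) (ht : t₀ < t)
    (hk : IsLeast {x ∈ Icc x₀ x₁ |
      ∫ ω in {ω | X ω ≤ x}, S ω s ∂μ = ∫ ω in B, S ω s ∂μ} k) :
    ∫ ω in {ω | X ω ≤ k}, S ω t ∂μ ≤ ∫ ω in B, S ω t ∂μ := by
  set K : Set Ω := {ω | X ω ≤ k} with hK
  have hms : ∀ x, MeasurableSet {ω | X ω ≤ x} := fun x => hX measurableSet_Iic
  have hKm : MeasurableSet K := hms k
  have hint : ∀ u, Integrable (fun ω => S ω u) μ := h.integrable μ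
  have hKs : ∀ u, ∫ ω in K, S ω u ∂μ
      = ∫ ω in K ∩ B, S ω u ∂μ + ∫ ω in K \ B, S ω u ∂μ := fun u =>
    (integral_inter_add_sdiff hB (hint u).integrableOn).symm
  have hBs : ∀ u, ∫ ω in B, S ω u ∂μ
      = ∫ ω in K ∩ B, S ω u ∂μ + ∫ ω in B \ K, S ω u ∂μ := fun u => by
    rw [inter_comm]; exact (integral_inter_add_sdiff hKm (hint u).integrableOn).symm
  obtain ⟨⟨hkI, hke⟩, hmin⟩ := hk
  have ha : ∫ ω in K \ B, S ω s ∂μ = ∫ ω in B \ K, S ω s ∂μ := by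
    have h1 := hKs s
    have h2 := hBs s
    linarith
  rw [hKs, hBs]
  gcongr 1
  set a := ∫ ω in B \ K, S ω s ∂μ with hadef
  have ha0 : 0 ≤ a := integral_nonneg fun ω => h.nonneg ω s
  -- Every point of `K \ B` ranks below every point of `B \ K`. Integrating the cross inequality
  -- over both sets leaves the common `s`-surplus `a` as a factor on each side, to be cancelled when
  -- positive.
  have hpt : ∀ ω ∈ K \ B, S ω t * a ≤ S ω s * ∫ ω in B \ K, S ω t ∂μ := by
    intro ω hω
    rw [hadef, ← integral_const_mul, ← integral_const_mul]
    refine setIntegral_mono_on ((hint s).const_mul _).integrableOn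
      ((hint t).const_mul _).integrableOn (hB.diff hKm) fun ω' hω' => ?_
    have hlt : k < X ω' := not_le.1 hω'.2
    have hle : X ω ≤ k := hω.1
    exact h.cross ω ω' (hle.trans hlt.le) s t hst
  have hmul : (∫ ω in K \ B, S ω t ∂μ) * a ≤ a * ∫ ω in B \ K, S ω t ∂μ := by
    rw [← integral_mul_const, ← ha, ← integral_mul_const]
    refine setIntegral_mono_on ((hint t).mul_const _).integrableOn
      ((hint s).mul_const _).integrableOn (hKm.diff hB) fun ω hω => ?_
    rw [ha]
    exact hpt ω hω
  -- If `a = 0` there is nothing to cancel. Then `K \ B` must be null: a point of it below level `k`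
  -- with zero surplus at `s` forces zero surplus at `s` on everything ranked above, so its own
  -- level would already give the required integral, against the minimality of `k`.
  rcases ha0.eq_or_lt with ha0 | ha0
  · have hz : (fun ω => S ω s) =ᵐ[μ.restrict (K \ B)] 0 :=
      (integral_eq_zero_iff_of_nonneg (fun ω => h.nonneg ω s) (hint s).integrableOn).1
        (ha.trans ha0.symm)
    have hz' := (ae_restrict_iff' (hKm.diff hB)).1 hz
    have hnull : μ (K \ B) = 0 := by
      rw [measure_eq_zero_iff_ae_notMem]
      filter_upwards [hz', hXI, hX0 k] with ω h1 h2 h3 h4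
      have hlt : X ω < k := lt_of_le_of_ne h4.1 h3
      have hs0 : S ω s = 0 := h1 h4
      have hzero : ∀ ω', X ω ≤ X ω' → S ω' s = 0 := by
        intro ω' hω'
        have h5 := h.cross ω ω' hω' s t hst
        rw [hs0, zero_mul] at h5
        have h6 := h.pos ω t ht
        have h7 := h.nonneg ω' s
        nlinarith
      refine absurd (hmin ⟨h2, ?_⟩) (not_le.2 hlt)
      rw [← hke]
      have hsub : {ω' | X ω' ≤ X ω} ⊆ K := fun ω' hω' => (show X ω' ≤ X ω from hω').trans h4.1
      rw [← integral_inter_add_sdiff (hms (X ω)) (hint s).integrableOn (s := K),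
        inter_eq_right.2 hsub]
      rw [setIntegral_eq_zero_of_forall_eq_zero (t := K \ _), add_zero]
      intro ω' hω'
      exact hzero ω' (not_le.1 hω'.2).le
    rw [setIntegral_measure_zero _ hnull]
    exact integral_nonneg fun ω => h.nonneg ω t
  · rw [mul_comm] at hmul
    exact le_of_mul_le_mul_left hmul ha0

/-- Every real function on a non-empty set of reals has a sequence of points of the set
whose graph points are dense in the graph. -/
lemma exists_seq_dense_graph {I : Set ℝ} (hI : I.Nonempty) (k : ℝ → ℝ) :
    ∃ d : ℕ → ℝ, (∀ n, d n ∈ I) ∧ ∀ t ∈ I, ∀ ε > 0, ∃ n, |d n - t| < ε ∧ |k (d n) - k t| < ε := by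
  obtain ⟨D, hD, hDc, hDd⟩ := (TopologicalSpace.IsSeparable.of_separableSpace
    ((fun t => (t, k t)) '' I)).exists_countable_dense_subset
  obtain ⟨t, ht⟩ := hI
  have hne : D.Nonempty := by
    rw [← closure_nonempty_iff]
    exact ⟨_, hDd ⟨t, ht, rfl⟩⟩
  obtain ⟨e, he⟩ := hDc.exists_eq_range hne
  have hemem : ∀ n, ∃ s ∈ I, (s, k s) = e n := fun n => by
    have : e n ∈ D := he ▸ mem_range_self n
    exact hD this
  choose d hdI hde using hemem
  refine ⟨d, hdI, fun t ht ε hε => ?_⟩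
  have hcl := hDd ⟨t, ht, rfl⟩
  rw [he] at hcl
  obtain ⟨y, ⟨n, rfl⟩, hy⟩ := Metric.mem_closure_iff.1 hcl ε hε
  refine ⟨n, ?_⟩
  rw [← hde n, Prod.dist_eq, max_lt_iff, dist_comm, dist_comm (k t), Real.dist_eq,
    Real.dist_eq] at hy
  exact hy

/-- The upward incentive constraints, chained along finitely many cost types, bound the rent
from below. -/
lemma IsSurplusFamily.rent_ge_of_finset (h : IsSurplusFamily X S t₀ M) (μ : Measure Ω)
    [IsFiniteMeasure μ] (hX : Measurable X) {I : Set ℝ} {k V : ℝ → ℝ}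
    (hV0 : ∀ t ∈ I, 0 ≤ V t)
    (hV : ∀ s ∈ I, ∀ t ∈ I, s ≤ t → ∫ ω in {ω | X ω ≤ k s}, (S ω t - S ω s) ∂μ ≤ V t - V s)
    (D : Finset ℝ) : (∀ s ∈ D, s ∈ I) → ∀ t ∈ I, (∀ s ∈ D, s ≤ t) → ∀ σ : Ω → ℝ, Measurable σ →
      (∀ ω, σ ω = t ∨ σ ω ∈ D ∧ X ω ≤ k (σ ω)) → ∫ ω, (S ω t - S ω (σ ω)) ∂μ ≤ V t := by
  classical
  refine Finset.induction_on_max D ?_ ?_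
  · intro _ t ht _ σ _ hσ
    have : ∀ ω, σ ω = t := fun ω => by simpa using hσ ω
    simpa [this] using hV0 t ht
  · intro s D hs ih hDI t ht hDt σ hσm hσ
    have hsI : s ∈ I := hDI s (Finset.mem_insert_self s D)
    have hst : s ≤ t := hDt s (Finset.mem_insert_self s D)
    have hDI' : ∀ u ∈ D, u ∈ I := fun u hu => hDI u (Finset.mem_insert_of_mem hu)
    have hDt' : ∀ u ∈ D, u ≤ t := fun u hu => hDt u (Finset.mem_insert_of_mem hu)
    have hint : ∀ u {r : Ω → ℝ}, Measurable r → Integrable (fun ω => S ω u - S ω (r ω)) μ :=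
      fun u _ hr => (h.integrable μ u).sub (h.integrable_comp μ hr)
    -- If the last level `k s` is a record, all points started at or before `s` lie below it: the
    -- chain splits into the rent up to `s` and the single constraint from `s` to `t`.
    by_cases hrec : ∀ u ∈ D, k u ≤ k s
    · set σ' : Ω → ℝ := fun ω => if σ ω < s then σ ω else s with hσ'
      have hσ'm : Measurable σ' :=
        Measurable.ite (measurableSet_lt hσm measurable_const) hσm measurable_const
      have h1 := ih hDI' s hsI (fun u hu => (hs u hu).le) σ' hσ'm (fun ω => by
        by_cases hlt : σ ω < s
        · right
          simp only [hσ', if_pos hlt]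
          rcases hσ ω with h2 | ⟨h2, h3⟩
          · exact absurd hst (not_le.2 (h2 ▸ hlt))
          · exact ⟨(Finset.mem_insert.1 h2).resolve_left hlt.ne, h3⟩
        · left
          simp only [hσ', if_neg hlt])
      have h2 := hV s hsI t ht hst
      have hKm : MeasurableSet {ω | X ω ≤ k s} := hX measurableSet_Iic
      have hdiff : Integrable (fun ω => S ω t - S ω s) μ :=
        hint t measurable_const
      rw [← integral_indicator hKm] at h2
      have h3 : ∫ ω, (S ω t - S ω (σ ω)) ∂μ ≤ ∫ ω, ((S ω s - S ω (σ' ω))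
          + {ω | X ω ≤ k s}.indicator (fun ω => S ω t - S ω s) ω) ∂μ := by
        refine integral_mono (hint t hσm)
          ((hint s hσ'm).add (hdiff.indicator hKm)) fun ω => ?_
        have hmono := h.monotone ω
        have hts := hmono hst
        by_cases hlt : σ ω < s
        · have hXk : X ω ≤ k s := by
            rcases hσ ω with h2 | ⟨h2, h3⟩
            · exact absurd hst (not_le.2 (h2 ▸ hlt))
            · exact h3.trans (hrec _ ((Finset.mem_insert.1 h2).resolve_left hlt.ne))
          have hmem : ω ∈ {ω | X ω ≤ k s} := hXk
          simp only [hσ', if_pos hlt, indicator_of_mem hmem]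
          linarith
        · simp only [hσ', if_neg hlt]
          rcases hσ ω with h2 | ⟨h2, h3⟩
          · rw [h2]
            have : 0 ≤ {ω | X ω ≤ k s}.indicator (fun ω => S ω t - S ω s) ω :=
              indicator_apply_nonneg fun _ => by linarith
            linarith
          · have h4 : σ ω = s := by
              rcases Finset.mem_insert.1 h2 with h4 | h4
              · exact h4
              · exact absurd (hs _ h4) hlt
            rw [h4] at h3 ⊢
            have hmem : ω ∈ {ω | X ω ≤ k s} := h3
            rw [indicator_of_mem hmem]
            linarith
      rw [integral_add (hint s hσ'm) (hdiff.indicator hKm)] at h3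
      linarith
    · push Not at hrec
      -- Otherwise an earlier `u` has a higher level. Points started at `s` can start at `u`
      -- instead, which only raises the integral to be bounded, and `s` drops out of the chain.
      obtain ⟨u, hu, hku⟩ := hrec
      set σ' : Ω → ℝ := fun ω => if σ ω = s ∧ X ω ≤ k s then u else σ ω with hσ'
      have hσ'm : Measurable σ' :=
        Measurable.ite ((hσm (measurableSet_singleton s)).inter (hX measurableSet_Iic))
          measurable_const hσm
      have h1 := ih hDI' t ht hDt' σ' hσ'm (fun ω => by
        by_cases hc : σ ω = s ∧ X ω ≤ k s
        · right
          simp only [hσ', if_pos hc]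
          exact ⟨hu, hc.2.trans hku.le⟩
        · simp only [hσ', if_neg hc]
          rcases hσ ω with h2 | ⟨h2, h3⟩
          · exact Or.inl h2
          · rcases Finset.mem_insert.1 h2 with h4 | h4
            · exact absurd ⟨h4, h4 ▸ h3⟩ hc
            · exact Or.inr ⟨h4, h3⟩)
      refine le_trans (integral_mono (hint t hσm)
        (hint t hσ'm) fun ω => ?_) h1
      have : S ω (σ' ω) ≤ S ω (σ ω) := by
        refine h.monotone ω ?_
        by_cases hc : σ ω = s ∧ X ω ≤ k s
        · simp only [hσ', if_pos hc]
          rw [hc.1]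
          exact (hs u hu).le
        · simp only [hσ', if_neg hc, le_refl]
      linarith

/-- The running minimum of a sequence, started at `a`. -/
noncomputable def runningMin (a : ℝ) (e : ℕ → ℝ) : ℕ → ℝ
  | 0 => a
  | n + 1 => min (runningMin a e n) (e n)

lemma runningMin_antitone (a : ℝ) (e : ℕ → ℝ) : Antitone (runningMin a e) :=
  antitone_nat_of_succ_le fun _ => min_le_left _ _

lemma runningMin_succ_le (a : ℝ) (e : ℕ → ℝ) (n : ℕ) : runningMin a e (n + 1) ≤ e n :=
  min_le_right _ _

lemma runningMin_mem (a : ℝ) (e : ℕ → ℝ) (n : ℕ) :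
    runningMin a e n = a ∨ ∃ i < n, runningMin a e n = e i := by
  induction n with
  | zero => exact Or.inl rfl
  | succ n ih =>
    rcases min_choice (runningMin a e n) (e n) with hc | hc
    · rcases ih with h | ⟨i, hi, h⟩
      · exact Or.inl (hc.trans h)
      · exact Or.inr ⟨i, hi.trans n.lt_succ_self, hc.trans h⟩
    · exact Or.inr ⟨n, n.lt_succ_self, hc⟩

lemma measurable_runningMin (a : ℝ) {e : ℕ → Ω → ℝ} (he : ∀ n, Measurable (e n)) (n : ℕ) :
    Measurable (fun ω => runningMin a (fun i => e i ω) n) := by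
  induction n with
  | zero => exact measurable_const
  | succ n ih => exact ih.min (he n)

/-- Given levels `k t` for `t ∈ [t₀, t₁]`, there is a measurable first time `τ` at which the
levels reach `X`, up to ties, that is approximated by a sequence of times. -/
lemma exists_hitting_time (hX : Measurable X) {t₁ : ℝ} (ht : t₀ ≤ t₁) (k : ℝ → ℝ) :
    ∃ (d : ℕ → ℝ) (τ : Ω → ℝ), (∀ n, d n ∈ Icc t₀ t₁) ∧ Measurable τ ∧ (∀ ω, t₀ ≤ τ ω) ∧
      (∀ ω x, τ ω < x → x ≤ t₁ → ∃ n, X ω ≤ k (d n) ∧ d n < x) ∧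
      ∀ t ∈ Icc t₀ t₁, ∀ ω, X ω < k t → τ ω ≤ t := by
  -- The levels `k` carry no regularity, so the infimum over all types might not be measurable.
  -- Countably many types dense in the graph of `k` suffice, except for ties `X ω = k t`. The
  -- default `t₁ + 1` means never served.
  obtain ⟨d, hdI, hd⟩ := exists_seq_dense_graph (nonempty_Icc.2 ht) k
  have hle : ∀ ω n, t₀ ≤ if X ω ≤ k (d n) then d n else t₁ + 1 := fun ω n => by
    split_ifs
    · exact (hdI n).1
    · linarith
  have hbdd : ∀ ω, BddBelow (range fun n => if X ω ≤ k (d n) then d n else t₁ + 1) := fun ω =>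
    ⟨t₀, by rintro _ ⟨n, rfl⟩; exact hle ω n⟩
  refine ⟨d, fun ω => ⨅ n, if X ω ≤ k (d n) then d n else t₁ + 1, hdI, ?_, ?_, ?_, ?_⟩
  · exact Measurable.iInf fun n =>
      Measurable.ite (hX measurableSet_Iic) measurable_const measurable_const
  · exact fun ω => le_ciInf (hle ω)
  · intro ω x hx hxt
    obtain ⟨n, hn⟩ := exists_lt_of_ciInf_lt hx
    refine ⟨n, ?_⟩
    split_ifs at hn with hc
    · exact ⟨hc, hn⟩
    · linarith
  · intro t ht ω hω
    refine le_of_forall_pos_le_add fun ε hε => ?_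
    obtain ⟨n, h1, h2⟩ := hd t ht (min ε (k t - X ω)) (lt_min hε (sub_pos.2 hω))
    rw [lt_min_iff] at h1 h2
    have h3 : X ω ≤ k (d n) := by linarith [(abs_lt.1 h2.2).1]
    refine (ciInf_le (hbdd ω) n).trans ?_
    rw [if_pos h3]
    linarith [(abs_lt.1 h1.1).2]

/-- The upward incentive constraints bound the rent from below by the rent of the monotone
mechanism that serves `ω` from the first cost type at which some level `k` reaches `X ω`. -/
lemma IsSurplusFamily.rent_ge (h : IsSurplusFamily X S t₀ M) (μ : Measure Ω)
    [IsFiniteMeasure μ] (hX : Measurable X) {t₁ : ℝ} {k V : ℝ → ℝ}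
    (hV0 : ∀ t ∈ Icc t₀ t₁, 0 ≤ V t)
    (hV : ∀ s ∈ Icc t₀ t₁, ∀ t ∈ Icc t₀ t₁, s ≤ t →
      ∫ ω in {ω | X ω ≤ k s}, (S ω t - S ω s) ∂μ ≤ V t - V s)
    {d : ℕ → ℝ} (hd : ∀ n, d n ∈ Icc t₀ t₁) {τ : Ω → ℝ} (hτm : Measurable τ)
    (hτ : ∀ ω x, τ ω < x → x ≤ t₁ → ∃ n, X ω ≤ k (d n) ∧ d n < x)
    {t : ℝ} (ht : t ∈ Icc t₀ t₁) :
    ∫ ω, {ω | τ ω ≤ t}.indicator (fun ω => S ω t - S ω (τ ω)) ω ∂μ ≤ V t := by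
  classical
  -- The default `t` contributes `S ω t - S ω t = 0`. The running minima of `e` are finite-chain
  -- starting times, and their limit lies below `τ` wherever `τ ω ≤ t`.
  set e : ℕ → Ω → ℝ := fun i ω => if X ω ≤ k (d i) ∧ d i ≤ t then d i else t with he
  have hem : ∀ i, Measurable (e i) := fun i =>
    Measurable.ite ((hX measurableSet_Iic).inter (MeasurableSet.const _))
      measurable_const measurable_const
  have het : ∀ i ω, e i ω ∈ Icc t₀ t := fun i ω => by
    simp only [he]
    split_ifs with hc
    · exact ⟨(hd i).1, hc.2⟩
    · exact ⟨ht.1, le_rfl⟩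
  set σ : ℕ → Ω → ℝ := fun n ω => runningMin t (fun i => e i ω) n with hσ
  have hσm : ∀ n, Measurable (σ n) := measurable_runningMin t hem
  have hσI : ∀ n ω, σ n ω ∈ Icc t₀ t := fun n ω => by
    rcases runningMin_mem t (fun i => e i ω) n with h1 | ⟨i, -, h1⟩
    · simp only [hσ, h1]; exact ⟨ht.1, le_rfl⟩
    · simp only [hσ, h1]; exact het i ω
  have hle : ∀ n, ∫ ω, (S ω t - S ω (σ n ω)) ∂μ ≤ V t := fun n => by
    refine h.rent_ge_of_finset μ hX hV0 hV (((Finset.range n).image d).filter (· ≤ t))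
      ?_ t ht ?_ (σ n) (hσm n) fun ω => ?_
    · intro s hs
      obtain ⟨i, -, rfl⟩ := Finset.mem_image.1 (Finset.mem_filter.1 hs).1
      exact hd i
    · exact fun s hs => (Finset.mem_filter.1 hs).2
    · rcases runningMin_mem t (fun i => e i ω) n with h1 | ⟨i, hi, h1⟩
      · exact Or.inl h1
      · have h2 : σ n ω = e i ω := h1
        by_cases hc : X ω ≤ k (d i) ∧ d i ≤ t
        · have h3 : σ n ω = d i := by rw [h2]; exact if_pos hc
          rw [h3]
          exact Or.inr ⟨Finset.mem_filter.2 ⟨Finset.mem_image_of_mem d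
            (Finset.mem_range.2 hi), hc.2⟩, hc.1⟩
        · left
          rw [h2]
          exact if_neg hc
  have hbdd : ∀ ω, BddBelow (range fun n => σ n ω) := fun ω =>
    ⟨t₀, by rintro _ ⟨n, rfl⟩; exact (hσI n ω).1⟩
  set L : Ω → ℝ := fun ω => ⨅ n, σ n ω with hL
  have hLm : Measurable L := Measurable.iInf hσm
  have hlim : ∀ ω, Tendsto (fun n => σ n ω) atTop (𝓝 (L ω)) := fun ω =>
    tendsto_atTop_ciInf (runningMin_antitone t _) (hbdd ω)
  have hint : ∀ {r : Ω → ℝ}, Measurable r → Integrable (fun ω => S ω t - S ω (r ω)) μ :=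
    fun hr => (h.integrable μ t).sub (h.integrable_comp μ hr)
  have hconv : Tendsto (fun n => ∫ ω, (S ω t - S ω (σ n ω)) ∂μ) atTop
      (𝓝 (∫ ω, (S ω t - S ω (L ω)) ∂μ)) := by
    refine tendsto_integral_of_dominated_convergence (fun _ => M)
      (fun n => (hint (hσm n)).aestronglyMeasurable) (integrable_const M)
      (fun n => ae_of_all _ fun ω => ?_) (ae_of_all _ fun ω => ?_)
    · rw [Real.norm_eq_abs, abs_le]
      have h1 := h.nonneg ω t
      have h2 := h.nonneg ω (σ n ω)
      have h3 := h.le ω t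
      have h4 := h.le ω (σ n ω)
      constructor <;> linarith
    · exact tendsto_const_nhds.sub (((h.continuous ω).tendsto _).comp (hlim ω))
  refine le_trans ?_ (le_of_tendsto' hconv hle)
  refine integral_mono ((hint hτm).indicator (hτm measurableSet_Iic)) (hint hLm) fun ω => ?_
  have hLt : L ω ≤ t := (ciInf_le (hbdd ω) 0).trans (hσI 0 ω).2
  by_cases hc : τ ω ≤ t
  · have hmem : ω ∈ {ω | τ ω ≤ t} := hc
    rw [indicator_of_mem hmem]
    have hLτ : L ω ≤ τ ω := by
      refine le_of_forall_gt_imp_ge_of_dense fun x hx => ?_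
      rcases le_total x t with hxt | hxt
      · obtain ⟨n, h1, h2⟩ := hτ ω x hx (hxt.trans ht.2)
        refine (ciInf_le (hbdd ω) (n + 1)).trans ((runningMin_succ_le t _ n).trans ?_)
        simp only [he]
        rw [if_pos ⟨h1, h2.le.trans hxt⟩]
        exact h2.le
      · exact hLt.trans hxt
    exact sub_le_sub_left (h.monotone ω hLτ) _
  · have hmem : ω ∉ {ω | τ ω ≤ t} := hc
    rw [indicator_of_notMem hmem]
    exact sub_nonneg.2 (h.monotone ω hLt)

/-- The regulator's payoff from a cutoff mechanism is surplus net of weighted rents. -/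
lemma IsSurplusFamily.integral_cutoff_eq (h : IsSurplusFamily X S t₀ M) (μ : Measure Ω)
    [IsFiniteMeasure μ] {τ : Ω → ℝ} (hτm : Measurable τ) (α t : ℝ) :
    ∫ ω, {ω | τ ω ≤ t}.indicator (fun ω => α * S ω t + (1 - α) * S ω (τ ω)) ω ∂μ
      = ∫ ω, {ω | τ ω ≤ t}.indicator (fun ω => S ω t) ω ∂μ
        - (1 - α) * ∫ ω, {ω | τ ω ≤ t}.indicator (fun ω => S ω t - S ω (τ ω)) ω ∂μ := by
  have hTm : MeasurableSet {ω | τ ω ≤ t} := hτm measurableSet_Iic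
  have hdiff : Integrable (fun ω => S ω t - S ω (τ ω)) μ :=
    (h.integrable μ t).sub (h.integrable_comp μ hτm)
  rw [← integral_const_mul, ← integral_sub ((h.integrable μ t).indicator hTm)
    ((hdiff.indicator hTm).const_mul _)]
  congr 1
  ext ω
  by_cases hc : ω ∈ {ω | τ ω ≤ t}
  · simp only [indicator_of_mem hc]; ring
  · simp only [indicator_of_notMem hc]; ring

/-- A mechanism with sale sets `B t` and rents `V t` is dominated by a monotone mechanism that
serves `ω` for the cost types above `τ ω`. -/
lemma IsSurplusFamily.exists_dominating (h : IsSurplusFamily X S t₀ M) (μ : Measure Ω)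
    [IsProbabilityMeasure μ] {x₀ x₁ t₁ : ℝ} (hx : x₀ ≤ x₁) (ht : t₀ ≤ t₁)
    (hX : Measurable X) (hXI : ∀ᵐ ω ∂μ, X ω ∈ Icc x₀ x₁) (hX0 : ∀ x, ∀ᵐ ω ∂μ, X ω ≠ x)
    {B : ℝ → Set Ω} (hB : ∀ t, MeasurableSet (B t)) {V : ℝ → ℝ}
    (hV0 : ∀ t ∈ Icc t₀ t₁, 0 ≤ V t)
    (hV : ∀ s ∈ Icc t₀ t₁, ∀ t ∈ Icc t₀ t₁, s ≤ t →
      ∫ ω in B s, (S ω t - S ω s) ∂μ ≤ V t - V s)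
    {α : ℝ} (hα : α ≤ 1) :
    ∃ τ : Ω → ℝ, Measurable τ ∧ (∀ ω, t₀ ≤ τ ω) ∧ ∀ t ∈ Icc t₀ t₁,
      ∫ ω in B t, S ω t ∂μ - (1 - α) * V t ≤
        ∫ ω, {ω | τ ω ≤ t}.indicator (fun ω => α * S ω t + (1 - α) * S ω (τ ω)) ω ∂μ := by
  choose k hk using fun s => exists_isLeast_threshold μ hx hX hXI hX0 (h.integrable μ s)
    (fun ω => h.nonneg ω s) (B s)
  obtain ⟨d, τ, hd, hτm, hτ0, hτ, hτk⟩ := exists_hitting_time (t₀ := t₀) hX ht k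
  have hVk : ∀ s ∈ Icc t₀ t₁, ∀ t ∈ Icc t₀ t₁, s ≤ t →
      ∫ ω in {ω | X ω ≤ k s}, (S ω t - S ω s) ∂μ ≤ V t - V s := by
    intro s hs t ht' hst
    refine le_trans ?_ (hV s hs t ht' hst)
    -- The case `s = t` is separate because the comparison of thresholds needs `t₀ < t`.
    rcases hst.eq_or_lt with rfl | hlt
    · simp
    · rw [integral_sub (h.integrable μ t).integrableOn (h.integrable μ s).integrableOn,
        integral_sub (h.integrable μ t).integrableOn (h.integrable μ s).integrableOn,
        (hk s).1.2]
      exact sub_le_sub_right (h.setIntegral_threshold_le μ hX hXI hX0 (hB s) hst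
        (hs.1.trans_lt hlt) (hk s)) _
  refine ⟨τ, hτm, hτ0, fun t ht' => ?_⟩
  have hrent := h.rent_ge μ hX hV0 hVk hd hτm hτ ht'
  have hTm : MeasurableSet {ω | τ ω ≤ t} := hτm measurableSet_Iic
  have hsurp : ∫ ω in B t, S ω t ∂μ ≤ ∫ ω, {ω | τ ω ≤ t}.indicator (fun ω => S ω t) ω ∂μ := by
    rw [← (hk t).1.2, ← integral_indicator (s := {ω | X ω ≤ k t}) (hX measurableSet_Iic)]
    refine integral_mono_ae ((h.integrable μ t).indicator (hX measurableSet_Iic))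
      ((h.integrable μ t).indicator hTm) ?_
    filter_upwards [hX0 (k t)] with ω hω
    by_cases hc : X ω ≤ k t
    · have h1 : ω ∈ {ω | τ ω ≤ t} := hτk t ht' ω (lt_of_le_of_ne hc hω)
      rw [indicator_of_mem h1, indicator_of_mem (s := {ω | X ω ≤ k t}) hc]
    · rw [indicator_of_notMem (s := {ω | X ω ≤ k t}) hc]
      exact indicator_apply_nonneg fun _ => h.nonneg ω t
  rw [h.integral_cutoff_eq μ hτm]
  have := mul_le_mul_of_nonneg_left hrent (sub_nonneg.2 hα)
  linarith

end Abstract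

/-! ### Optimal cutoffs, consumer by consumer. -/

/-- The regulator's payoff, in expectation over cost types `t ∼ F`, from serving a consumer with
surplus `s` exactly for the cost types above `τ`. -/
noncomputable def cutoffValue (F : Measure ℝ) (α : ℝ) (s : ℝ → ℝ) (τ : ℝ) : ℝ :=
  ∫ t, (Ici τ).indicator (fun t => α * s t + (1 - α) * s τ) t ∂F

lemma integrable_cutoff (F : Measure ℝ) [IsFiniteMeasure F] (α : ℝ) {s : ℝ → ℝ} {M : ℝ}
    (hsc : Continuous s) (hs0 : ∀ t, 0 ≤ s t) (hsM : ∀ t, s t ≤ M) (τ : ℝ) :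
    Integrable (fun t => (Ici τ).indicator (fun t => α * s t + (1 - α) * s τ) t) F :=
  (((Integrable.of_bound hsc.measurable.aestronglyMeasurable M (ae_of_all _ fun t => by
      rw [Real.norm_eq_abs, abs_of_nonneg (hs0 t)]; exact hsM t)).const_mul α).add
    (integrable_const _)).indicator measurableSet_Ici

/-- Continuity can fail at atoms of `F`: moving `τ` above an atom loses it. Freezing the served set
when `τ` exceeds `x`, via `Ici (min x x')`, gives a majorant that is continuous at `x` and agrees
there. -/
lemma upperSemicontinuous_cutoffValue (F : Measure ℝ) [IsFiniteMeasure F] {α : ℝ}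
    (hα : α ∈ Icc (0 : ℝ) 1) {s : ℝ → ℝ} {M : ℝ}
    (hsc : Continuous s) (hs0 : ∀ t, 0 ≤ s t) (hsM : ∀ t, s t ≤ M) :
    UpperSemicontinuous (cutoffValue F α s) := by
  intro x y hy
  have hα1 : 0 ≤ 1 - α := sub_nonneg.2 hα.2
  have hpos : ∀ t x', 0 ≤ α * s t + (1 - α) * s x' := fun t x' =>
    add_nonneg (mul_nonneg hα.1 (hs0 t)) (mul_nonneg hα1 (hs0 x'))
  set u : ℝ → ℝ → ℝ := fun x' t =>
    (Ici (min x x')).indicator (fun t => α * s t + (1 - α) * s x') t with hu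
  have hum : ∀ x', Measurable (u x') := fun x' =>
    ((hsc.measurable.const_mul α).add measurable_const).indicator measurableSet_Ici
  have hub : ∀ x' t, ‖u x' t‖ ≤ M := fun x' t => by
    refine (norm_indicator_le_norm_self _ _).trans ?_
    rw [Real.norm_eq_abs, abs_of_nonneg (hpos t x')]
    nlinarith [mul_le_mul_of_nonneg_left (hsM t) hα.1, mul_le_mul_of_nonneg_left (hsM x') hα1]
  have hcont : ContinuousAt (fun x' => ∫ t, u x' t ∂F) x := by
    refine continuousAt_of_dominated (bound := fun _ => M)
      (Eventually.of_forall fun x' => (hum x').aestronglyMeasurable)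
      (Eventually.of_forall fun x' => ae_of_all _ (hub x')) (integrable_const M)
      (ae_of_all _ fun t => ?_)
    by_cases hxt : x ≤ t
    · have : (fun x' => u x' t) = fun x' => α * s t + (1 - α) * s x' := by
        ext x'
        exact indicator_of_mem (s := Ici (min x x')) ((min_le_left _ _).trans hxt) _
      rw [this]
      exact (continuous_const.add (continuous_const.mul hsc)).continuousAt
    · have : (fun x' => u x' t) =ᶠ[𝓝 x] fun _ => 0 := by
        filter_upwards [eventually_gt_nhds (not_le.1 hxt)] with x' hx'
        exact indicator_of_notMem (s := Ici (min x x'))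
          (not_le.2 (lt_min (not_le.1 hxt) hx')) _
      exact continuousAt_const.congr this.symm
  have hux : ∫ t, u x t ∂F = cutoffValue F α s x := by
    simp only [hu, min_self, cutoffValue]
  have hev := hcont.eventually (eventually_lt_nhds (hux ▸ hy))
  filter_upwards [hev] with x' hx'
  refine lt_of_le_of_lt ?_ hx'
  refine integral_mono (integrable_cutoff F α hsc hs0 hsM x')
    (Integrable.of_bound (hum x').aestronglyMeasurable M (ae_of_all _ (hub x'))) fun t => ?_
  exact indicator_le_indicator_of_subset (Ici_subset_Ici.2 (min_le_right _ _))
    (fun t => hpos t x') t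

section Abstract

variable {Ω : Type*} [MeasurableSpace Ω] {X : Ω → ℝ} {S : Ω → ℝ → ℝ} {t₀ M : ℝ}

/-- Single crossing: when `S ω' τ'` is positive and `ω'` weakly prefers the lower cutoff, so does
the lower-ranked `ω`. The inequality holds for each `t`, by the cross inequality at `(τ, τ')` and,
for types gained by the lower cutoff, also at `(t, τ')`. -/
lemma IsSurplusFamily.cutoffValue_cross (h : IsSurplusFamily X S t₀ M) (F : Measure ℝ)
    [IsFiniteMeasure F] {α : ℝ} (hα : α ∈ Icc (0 : ℝ) 1) {ω ω' : Ω} (hω : X ω ≤ X ω')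
    {τ τ' : ℝ} (hτ : τ ≤ τ') :
    S ω τ' * (cutoffValue F α (S ω') τ - cutoffValue F α (S ω') τ')
      ≤ S ω' τ' * (cutoffValue F α (S ω) τ - cutoffValue F α (S ω) τ') := by
  have hint : ∀ ω x, Integrable
      (fun t => (Ici x).indicator (fun t => α * S ω t + (1 - α) * S ω x) t) F := fun ω x =>
    integrable_cutoff F α (h.continuous ω) (h.nonneg ω) (h.le ω) x
  unfold cutoffValue
  rw [← integral_sub (hint _ _) (hint _ _), ← integral_sub (hint _ _) (hint _ _),
    ← integral_const_mul, ← integral_const_mul]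
  refine integral_mono (((hint _ _).sub (hint _ _)).const_mul _)
    (((hint _ _).sub (hint _ _)).const_mul _) fun t => ?_
  have hα1 : 0 ≤ 1 - α := sub_nonneg.2 hα.2
  have h1 := mul_le_mul_of_nonneg_left (h.cross ω ω' hω τ τ' hτ) hα1
  simp only
  by_cases h3 : τ' ≤ t
  · rw [indicator_of_mem (s := Ici τ) (hτ.trans h3), indicator_of_mem (s := Ici τ') h3,
      indicator_of_mem (s := Ici τ) (hτ.trans h3), indicator_of_mem (s := Ici τ') h3]
    linarith
  · rw [indicator_of_notMem (s := Ici τ') h3, indicator_of_notMem (s := Ici τ') h3]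
    by_cases h4 : τ ≤ t
    · rw [indicator_of_mem (s := Ici τ) h4, indicator_of_mem (s := Ici τ) h4]
      have h2 := mul_le_mul_of_nonneg_left (h.cross ω ω' hω t τ' (not_le.1 h3).le) hα.1
      linarith
    · rw [indicator_of_notMem (s := Ici τ) h4, indicator_of_notMem (s := Ici τ) h4]
      simp

/-- The payoff-maximizing cutoffs can be chosen increasing in the ranking. -/
lemma IsSurplusFamily.exists_optimal_cutoff (h : IsSurplusFamily X S t₀ M) {t₁ : ℝ}
    (ht : t₀ ≤ t₁) (F : Measure ℝ) [IsFiniteMeasure F] (hF : F (Icc t₀ t₁)ᶜ = 0) {α : ℝ}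
    (hα : α ∈ Icc (0 : ℝ) 1) :
    ∃ m : Ω → ℝ, (∀ ω, m ω ∈ Icc t₀ t₁) ∧ (∀ ω ω', X ω ≤ X ω' → m ω ≤ m ω') ∧
      ∀ ω τ, t₀ ≤ τ → cutoffValue F α (S ω) τ ≤ cutoffValue F α (S ω) (m ω) := by
  have husc : ∀ ω, UpperSemicontinuous (cutoffValue F α (S ω)) := fun ω =>
    upperSemicontinuous_cutoffValue F hα (h.continuous ω) (h.nonneg ω) (h.le ω)
  have hex : ∀ ω, ∃ m, IsLeast {x ∈ Icc t₀ t₁ |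
      ∀ τ ∈ Icc t₀ t₁, cutoffValue F α (S ω) τ ≤ cutoffValue F α (S ω) x} m := by
    intro ω
    obtain ⟨a, ha, hmax⟩ := ((husc ω).upperSemicontinuousOn _).exists_isMaxOn
      (nonempty_Icc.2 ht) isCompact_Icc
    have hset : {x ∈ Icc t₀ t₁ |
        ∀ τ ∈ Icc t₀ t₁, cutoffValue F α (S ω) τ ≤ cutoffValue F α (S ω) x}
        = Icc t₀ t₁ ∩ cutoffValue F α (S ω) ⁻¹' Ici (cutoffValue F α (S ω) a) := by
      ext x
      exact ⟨fun hx => ⟨hx.1, hx.2 a ha⟩, fun hx => ⟨hx.1, fun τ hτ => (hmax hτ).trans hx.2⟩⟩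
    rw [hset]
    exact (isCompact_Icc.inter_right ((husc ω).isClosed_preimage _)).exists_isLeast
      ⟨a, ha, mem_preimage.2 (mem_Ici.2 le_rfl)⟩
  choose m hm using hex
  have hnn : ∀ ω x, 0 ≤ cutoffValue F α (S ω) x := fun ω x =>
    integral_nonneg fun t => indicator_apply_nonneg fun _ =>
      add_nonneg (mul_nonneg hα.1 (h.nonneg ω t))
        (mul_nonneg (sub_nonneg.2 hα.2) (h.nonneg ω x))
  refine ⟨m, fun ω => (hm ω).1.1, fun ω ω' hω => ?_, fun ω τ hτ => ?_⟩
  -- If `m ω' < m ω`, then `ω'` weakly prefers `m ω'`, hence so does `ω`, and `m ω` is not the least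
  -- maximizer.
  · by_contra! hlt
    have h1 := h.cutoffValue_cross F hα hω hlt.le
    have h2 := (hm ω').1.2 (m ω) (hm ω).1.1
    have hpos : 0 < S ω' (m ω) := h.pos ω' _ ((hm ω').1.1.1.trans_lt hlt)
    have h3 : 0 ≤ S ω' (m ω) * (cutoffValue F α (S ω) (m ω') - cutoffValue F α (S ω) (m ω)) :=
      (mul_nonneg (h.nonneg ω _) (sub_nonneg.2 h2)).trans h1
    have h4 := nonneg_of_mul_nonneg_right h3 hpos
    refine absurd ((hm ω).2 ⟨(hm ω').1.1, fun τ hτ => ?_⟩) (not_le.2 hlt)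
    linarith [(hm ω).1.2 τ hτ]
  · rcases le_or_gt τ t₁ with hle | hgt
    · exact (hm ω).1.2 τ ⟨hτ, hle⟩
    · have hzero : cutoffValue F α (S ω) τ = 0 := by
        refine integral_eq_zero_of_ae ?_
        have hFI : ∀ᵐ t ∂F, t ∈ Icc t₀ t₁ := hF
        filter_upwards [hFI] with t ht'
        exact indicator_of_notMem (s := Ici τ) (not_le.2 (ht'.2.trans_lt hgt)) _
      rw [hzero]
      exact hnn ω _

/-- Exchanging the order of integration over consumers and cost types. -/
lemma IsSurplusFamily.integral_cutoffValue (h : IsSurplusFamily X S t₀ M) (μ : Measure Ω)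
    [IsFiniteMeasure μ] (F : Measure ℝ) [IsFiniteMeasure F] {α : ℝ} (hα : α ∈ Icc (0 : ℝ) 1)
    {τ : Ω → ℝ} (hτ : Measurable τ) :
    Integrable (fun ω => cutoffValue F α (S ω) (τ ω)) μ ∧
    Integrable (fun t => ∫ ω, {ω | τ ω ≤ t}.indicator
      (fun ω => α * S ω t + (1 - α) * S ω (τ ω)) ω ∂μ) F ∧
    ∫ t, ∫ ω, {ω | τ ω ≤ t}.indicator (fun ω => α * S ω t + (1 - α) * S ω (τ ω)) ω ∂μ ∂F
      = ∫ ω, cutoffValue F α (S ω) (τ ω) ∂μ := by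
  have hα1 : 0 ≤ 1 - α := sub_nonneg.2 hα.2
  have hm : Measurable (fun z : ℝ × Ω => {z : ℝ × Ω | τ z.2 ≤ z.1}.indicator
      (fun z => α * S z.2 z.1 + (1 - α) * S z.2 (τ z.2)) z) := by
    refine Measurable.indicator ?_ (measurableSet_le (hτ.comp measurable_snd) measurable_fst)
    exact ((h.measurable.comp measurable_swap).const_mul α).add
      (((h.measurable_comp hτ).comp measurable_snd).const_mul (1 - α))
  have hint : Integrable (fun z : ℝ × Ω => {z : ℝ × Ω | τ z.2 ≤ z.1}.indicator
      (fun z => α * S z.2 z.1 + (1 - α) * S z.2 (τ z.2)) z) (F.prod μ) := by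
    refine Integrable.of_bound hm.aestronglyMeasurable M (ae_of_all _ fun z => ?_)
    refine (norm_indicator_le_norm_self _ _).trans ?_
    rw [Real.norm_eq_abs, abs_of_nonneg (add_nonneg (mul_nonneg hα.1 (h.nonneg _ _))
      (mul_nonneg hα1 (h.nonneg _ _)))]
    nlinarith [mul_le_mul_of_nonneg_left (h.le z.2 z.1) hα.1,
      mul_le_mul_of_nonneg_left (h.le z.2 (τ z.2)) hα1]
  exact ⟨hint.integral_prod_right, hint.integral_prod_left, integral_integral_swap hint⟩

/-- Treats the pair (value, device realization) as the consumer, so that random prices become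
deterministic sale sets. -/
lemma IsSurplusFamily.comp_fst {R : Type*} [MeasurableSpace R] (h : IsSurplusFamily X S t₀ M) :
    IsSurplusFamily (fun z : Ω × R => X z.1) (fun z : Ω × R => S z.1) t₀ M where
  measurable := h.measurable.comp ((measurable_fst.comp measurable_fst).prodMk measurable_snd)
  nonneg z := h.nonneg z.1
  le z := h.le z.1
  continuous z := h.continuous z.1
  monotone z := h.monotone z.1
  pos z := h.pos z.1
  cross z z' := h.cross z.1 z'.1

end Abstract

/-! ### From mechanisms to sale sets and rents, and back. -/

section Mechanism

lemma ae_fst_mem {R : Type*} [MeasurableSpace R] {ρ : Measure R} {θ₀ θ₁ : ℝ} {G : Measure ℝ}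
    (hG : G (Icc θ₀ θ₁)ᶜ = 0) : ∀ᵐ z ∂G.prod ρ, z.1 ∈ Icc θ₀ θ₁ :=
  Measure.quasiMeasurePreserving_fst.ae (show ∀ᵐ θ ∂G, θ ∈ Icc θ₀ θ₁ from hG)

variable {R : Type*} [MeasurableSpace R] {ρ : Measure R} [IsProbabilityMeasure ρ]
  {θ₀ θ₁ t₀ t₁ M : ℝ} {G : Measure ℝ} [IsProbabilityMeasure G]
  {c S : ℝ → ℝ → ℝ} {X : ℝ → ℝ}

/-- The pairs of a consumer value and a device realization at which a sale takes place. -/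
def saleSet (p : ℝ → R → ℝ) : Set (ℝ × R) := {z | p z.1 z.2 ≤ z.1}

lemma measurableSet_saleSet {p : ℝ → R → ℝ} (hp : Measurable (fun z : ℝ × R => p z.1 z.2)) :
    MeasurableSet (saleSet p) :=
  measurableSet_le hp measurable_fst

/-- Profit is the surplus of the sales net of consumer surplus. -/
lemma profit_eq (hG : G (Icc θ₀ θ₁)ᶜ = 0) (hS : IsSurplusFamily X S t₀ M) {t : ℝ}
    (hSc : ∀ θ ∈ Icc θ₀ θ₁, S θ t = totalSurplus c θ t) {p : ℝ → R → ℝ}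
    (hp : IsPricingRule G ρ p) :
    profit G ρ c p t = ∫ z in saleSet p, S z.1 t ∂(G.prod ρ)
      - ∫ θ, consumerSurplus ρ p θ ∂G := by
  have hB := measurableSet_saleSet hp.measurable
  have hi : Integrable (fun z : ℝ × R => S z.1 t) (G.prod ρ) :=
    (hS.comp_fst (R := R)).integrable _ t
  have hcs : ∫ θ, consumerSurplus ρ p θ ∂G
      = ∫ z : ℝ × R, max (z.1 - p z.1 z.2) 0 ∂(G.prod ρ) :=
    (integral_prod _ hp.integrable).symm
  rw [hcs, ← integral_indicator hB, ← integral_sub (hi.indicator hB) hp.integrable]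
  refine integral_congr_ae ?_
  filter_upwards [ae_fst_mem (ρ := ρ) hG] with z hz
  by_cases hc : p z.1 z.2 ≤ z.1
  · rw [indicator_of_mem (s := {z : ℝ × R | p z.1 z.2 ≤ z.1}) hc,
      indicator_of_mem (s := saleSet p) hc, hSc _ hz, max_eq_left (sub_nonneg.2 hc), totalSurplus]
    ring
  · rw [indicator_of_notMem (s := {z : ℝ × R | p z.1 z.2 ≤ z.1}) hc,
      indicator_of_notMem (s := saleSet p) hc, max_eq_right (by linarith), sub_zero]

lemma profit_sub_profit (hG : G (Icc θ₀ θ₁)ᶜ = 0) (hS : IsSurplusFamily X S t₀ M)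
    (hSc : ∀ θ ∈ Icc θ₀ θ₁, ∀ t ∈ Icc t₀ t₁, S θ t = totalSurplus c θ t) {p : ℝ → R → ℝ}
    (hp : IsPricingRule G ρ p) {s t : ℝ} (hs : s ∈ Icc t₀ t₁) (ht : t ∈ Icc t₀ t₁) :
    profit G ρ c p t - profit G ρ c p s
      = ∫ z in saleSet p, (S z.1 t - S z.1 s) ∂(G.prod ρ) := by
  have hi := fun u => ((hS.comp_fst (R := R)).integrable (G.prod ρ) u).integrableOn
    (s := saleSet p)
  rw [profit_eq hG hS (fun θ hθ => hSc θ hθ t ht) hp,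
    profit_eq hG hS (fun θ hθ => hSc θ hθ s hs) hp, integral_sub (hi t) (hi s)]
  ring

lemma measurable_profit (hcm : Measurable (fun z : ℝ × ℝ => c z.1 z.2))
    {p : ℝ → ℝ → R → ℝ} (hp : Measurable (fun z : ℝ × ℝ × R => p z.1 z.2.1 z.2.2)) :
    Measurable (fun t => profit G ρ c (p t) t) := by
  have hm : Measurable (fun w : ℝ × ℝ × R => {w : ℝ × ℝ × R | p w.1 w.2.1 w.2.2 ≤ w.2.1}.indicator
      (fun w => p w.1 w.2.1 w.2.2 - c w.2.1 w.1) w) := by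
    refine Measurable.indicator (hp.sub ?_) ?_
    · exact hcm.comp (measurable_snd.fst.prodMk measurable_fst)
    · exact measurableSet_le hp measurable_snd.fst
  exact (hm.stronglyMeasurable.integral_prod_right' (ν := G.prod ρ)).measurable

/-- Under incentive compatibility, rents are bounded and measurable, and the regulator's objective
is the expected surplus of the sales net of weighted rents. -/
lemma IsMechanism.objective_eq (hG : G (Icc θ₀ θ₁)ᶜ = 0) (ht : t₀ ≤ t₁)
    {F : Measure ℝ} [IsProbabilityMeasure F] (hF : F (Icc t₀ t₁)ᶜ = 0)
    (hcm : Measurable (fun z : ℝ × ℝ => c z.1 z.2)) (hS : IsSurplusFamily X S t₀ M)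
    (hSc : ∀ θ ∈ Icc θ₀ θ₁, ∀ t ∈ Icc t₀ t₁, S θ t = totalSurplus c θ t) (α : ℝ)
    {p : ℝ → ℝ → R → ℝ} {T : ℝ → ℝ} (hM : IsMechanism t₀ t₁ G ρ c p T) :
    Integrable (fun t => ∫ z in saleSet (p t), S z.1 t ∂(G.prod ρ)
      - (1 - α) * (profit G ρ c (p t) t - T t)) F ∧
    objective F G ρ c α p T = ∫ t, (∫ z in saleSet (p t), S z.1 t ∂(G.prod ρ)
      - (1 - α) * (profit G ρ c (p t) t - T t)) ∂F := by
  have hS' := hS.comp_fst (R := R)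
  have hFI : ∀ᵐ t ∂F, t ∈ Icc t₀ t₁ := hF
  have hpt : ∀ t, Measurable (fun z : ℝ × R => p t z.1 z.2) := fun t =>
    hM.measurable_price.comp (measurable_const.prodMk measurable_id)
  have hVint : Integrable (fun t => profit G ρ c (p t) t - T t) F := by
    refine Integrable.of_bound
      ((measurable_profit hcm hM.measurable_price).sub hM.measurable_tax).aestronglyMeasurable
      (profit G ρ c (p t₁) t₁ - T t₁) ?_
    filter_upwards [hFI] with t ht'
    rw [Real.norm_eq_abs, abs_of_nonneg (hM.individuallyRational t ht')]
    -- Type `t₁` can mimic `t` and earns at least as much surplus on the same sales, so its rent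
    -- bounds all others.
    have ht1 := right_mem_Icc.2 ht
    have h1 := hM.incentiveCompatible t₁ ht1 t ht'
    have h2 := profit_sub_profit hG hS hSc (hM.pricingRule t ht') ht' ht1
    have h3 : 0 ≤ ∫ z in saleSet (p t), (S z.1 t₁ - S z.1 t) ∂(G.prod ρ) :=
      integral_nonneg fun z => sub_nonneg.2 (hS.monotone z.1 ht'.2)
    linarith
  have hQm : Measurable (fun t => ∫ z in saleSet (p t), S z.1 t ∂(G.prod ρ)) := by
    simp_rw [fun t => (integral_indicator (μ := G.prod ρ) (f := fun z : ℝ × R => S z.1 t)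
      (measurableSet_saleSet (hpt t))).symm]
    have hm : Measurable (fun w : ℝ × ℝ × R =>
        {w : ℝ × ℝ × R | p w.1 w.2.1 w.2.2 ≤ w.2.1}.indicator (fun w => S w.2.1 w.1) w) := by
      refine Measurable.indicator ?_ ?_
      · exact hS.measurable.comp (measurable_snd.fst.prodMk measurable_fst)
      · exact measurableSet_le hM.measurable_price measurable_snd.fst
    exact (hm.stronglyMeasurable.integral_prod_right' (ν := G.prod ρ)).measurable
  have hQint : Integrable (fun t => ∫ z in saleSet (p t), S z.1 t ∂(G.prod ρ)) F := by
    refine Integrable.of_bound hQm.aestronglyMeasurable M (ae_of_all _ fun t => ?_)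
    rw [Real.norm_eq_abs, abs_of_nonneg (integral_nonneg fun z => hS.nonneg z.1 t)]
    refine (setIntegral_le_integral (hS'.integrable _ t)
      (ae_of_all _ fun z => hS.nonneg z.1 t)).trans ?_
    refine (integral_mono (hS'.integrable _ t) (integrable_const M)
      fun z => hS.le z.1 t).trans_eq (by simp)
  refine ⟨hQint.sub (hVint.const_mul _), ?_⟩
  unfold objective
  have h1 : ∫ t, ((∫ θ, consumerSurplus ρ (p t) θ ∂G) + T t) ∂F
      = ∫ t, (∫ z in saleSet (p t), S z.1 t ∂(G.prod ρ)
        - (profit G ρ c (p t) t - T t)) ∂F := by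
    refine integral_congr_ae ?_
    filter_upwards [hFI] with t ht'
    have := profit_eq hG hS (fun θ hθ => hSc θ hθ t ht') (hM.pricingRule t ht')
    linarith
  rw [h1, integral_sub hQint hVint, integral_sub hQint (hVint.const_mul _), integral_const_mul]
  ring

/-- Every mechanism gives the regulator at most the expected maximal cutoff payoff. -/
lemma IsMechanism.objective_le (hX : Measurable X)
    (hX0 : ∀ x, ∀ᵐ θ ∂G, X θ ≠ x)
    {x₀ x₁ : ℝ} (hXI : ∀ θ ∈ Icc θ₀ θ₁, X θ ∈ Icc x₀ x₁) (hx : x₀ ≤ x₁)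
    (hG : G (Icc θ₀ θ₁)ᶜ = 0) (ht : t₀ ≤ t₁)
    {F : Measure ℝ} [IsProbabilityMeasure F] (hF : F (Icc t₀ t₁)ᶜ = 0)
    (hcm : Measurable (fun z : ℝ × ℝ => c z.1 z.2)) (hS : IsSurplusFamily X S t₀ M)
    (hSc : ∀ θ ∈ Icc θ₀ θ₁, ∀ t ∈ Icc t₀ t₁, S θ t = totalSurplus c θ t)
    {α : ℝ} (hα : α ∈ Icc (0 : ℝ) 1) {m : ℝ → ℝ} (hm : Measurable m)
    (hmax : ∀ θ τ, t₀ ≤ τ → cutoffValue F α (S θ) τ ≤ cutoffValue F α (S θ) (m θ))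
    {p : ℝ → ℝ → R → ℝ} {T : ℝ → ℝ} (hM : IsMechanism t₀ t₁ G ρ c p T) :
    objective F G ρ c α p T ≤ ∫ z : ℝ × R, cutoffValue F α (S z.1) (m z.1) ∂(G.prod ρ) := by
  have hS' := hS.comp_fst (R := R)
  have hpt : ∀ t, Measurable (fun z : ℝ × R => p t z.1 z.2) := fun t =>
    hM.measurable_price.comp (measurable_const.prodMk measurable_id)
  obtain ⟨hint, hobj⟩ := hM.objective_eq hG ht hF hcm hS hSc α
  obtain ⟨τ, hτm, hτ0, hτ⟩ := hS'.exists_dominating (G.prod ρ) hx ht (hX.comp measurable_fst)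
    ((ae_fst_mem hG).mono fun z hz => hXI z.1 hz)
    (fun x => Measure.quasiMeasurePreserving_fst.ae (hX0 x))
    (B := fun t => saleSet (p t)) (fun t => measurableSet_saleSet (hpt t))
    (V := fun t => profit G ρ c (p t) t - T t) hM.individuallyRational
    (fun s hs t ht' _ => by
      have h1 := profit_sub_profit hG hS hSc (hM.pricingRule s hs) hs ht'
      have h2 := hM.incentiveCompatible t ht' s hs
      linarith) hα.2
  obtain ⟨hi1, hi2, heq⟩ := hS'.integral_cutoffValue (G.prod ρ) F hα hτm
  obtain ⟨hi3, -, -⟩ := hS'.integral_cutoffValue (G.prod ρ) F hα (hm.comp measurable_fst)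
  rw [hobj]
  -- The dominating cutoff `τ` may depend on the device, but the pointwise maximizer `m` depends on
  -- the value alone, so randomization gains nothing.
  refine (integral_mono_ae hint hi2 ?_).trans (heq.trans_le
    (integral_mono hi1 hi3 fun z => hmax z.1 (τ z) (hτ0 z)))
  have hFI : ∀ᵐ t ∂F, t ∈ Icc t₀ t₁ := hF
  filter_upwards [hFI] with t ht'
  exact hτ t ht'

/-- Prices that sell to consumer `θ` exactly for the cost types above `m θ` are implementable, and
leave the regulator the expected cutoff payoff. -/
lemma exists_tax (hG : G (Icc θ₀ θ₁)ᶜ = 0) (ht : t₀ ≤ t₁)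
    {F : Measure ℝ} [IsProbabilityMeasure F] (hF : F (Icc t₀ t₁)ᶜ = 0)
    (hcm : Measurable (fun z : ℝ × ℝ => c z.1 z.2)) (hS : IsSurplusFamily X S t₀ M)
    (hSc : ∀ θ ∈ Icc θ₀ θ₁, ∀ t ∈ Icc t₀ t₁, S θ t = totalSurplus c θ t)
    {α : ℝ} (hα : α ∈ Icc (0 : ℝ) 1) {m : ℝ → ℝ} (hm : Measurable m)
    {p : ℝ → ℝ → R → ℝ} (hp : Measurable (fun z : ℝ × ℝ × R => p z.1 z.2.1 z.2.2))
    (hpθ : ∀ t θ r, θ₀ ≤ θ → θ₀ ≤ p t θ r)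
    (hpm : ∀ t ∈ Icc t₀ t₁, ∀ᵐ z ∂G.prod ρ, p t z.1 z.2 ≤ z.1 ↔ m z.1 ≤ t) :
    ∃ T : ℝ → ℝ, IsMechanism t₀ t₁ G ρ c p T ∧
      objective F G ρ c α p T = ∫ z : ℝ × R, cutoffValue F α (S z.1) (m z.1) ∂(G.prod ρ) := by
  have hS' := hS.comp_fst (R := R)
  have hm' : Measurable (fun z : ℝ × R => m z.1) := hm.comp measurable_fst
  have hpt : ∀ t, Measurable (fun z : ℝ × R => p t z.1 z.2) := fun t =>
    hp.comp (measurable_const.prodMk measurable_id)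
  set V : ℝ → ℝ := fun t => ∫ z : ℝ × R, {z : ℝ × R | m z.1 ≤ t}.indicator
    (fun z => S z.1 t - S z.1 (m z.1)) z ∂(G.prod ρ) with hV
  have hVm : Measurable V := by
    have hmeas : Measurable (fun w : ℝ × ℝ × R => {w : ℝ × ℝ × R | m w.2.1 ≤ w.1}.indicator
        (fun w => S w.2.1 w.1 - S w.2.1 (m w.2.1)) w) := by
      refine Measurable.indicator (Measurable.sub ?_ ?_) ?_
      · exact hS.measurable.comp (measurable_snd.fst.prodMk measurable_fst)
      · exact (hS.measurable_comp hm).comp measurable_snd.fst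
      · exact measurableSet_le (hm.comp measurable_snd.fst) measurable_fst
    exact (hmeas.stronglyMeasurable.integral_prod_right' (ν := G.prod ρ)).measurable
  have hrule : ∀ t, IsPricingRule G ρ (p t) := fun t => by
    refine ⟨hpt t, Integrable.of_bound
      ((measurable_fst.sub (hpt t)).max measurable_const).aestronglyMeasurable |θ₁ - θ₀| ?_⟩
    filter_upwards [ae_fst_mem (ρ := ρ) hG] with z hz
    rw [Real.norm_eq_abs, abs_of_nonneg (le_max_right _ _)]
    refine max_le ((sub_le_sub hz.2 (hpθ t z.1 z.2 hz.1)).trans (le_abs_self _)) (abs_nonneg _)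
  have hset : ∀ t ∈ Icc t₀ t₁, saleSet (p t) =ᵐ[G.prod ρ] {z : ℝ × R | m z.1 ≤ t} := by
    intro t ht'
    filter_upwards [hpm t ht'] with z hz
    exact propext hz
  have hTm : ∀ t, MeasurableSet {z : ℝ × R | m z.1 ≤ t} := fun t => hm' measurableSet_Iic
  have hdiff : ∀ t, Integrable (fun z : ℝ × R => S z.1 t - S z.1 (m z.1)) (G.prod ρ) := fun t =>
    (hS'.integrable _ t).sub (hS'.integrable_comp _ hm')
  refine ⟨fun t => profit G ρ c (p t) t - V t, ?_⟩
  have hM : IsMechanism t₀ t₁ G ρ c p (fun t => profit G ρ c (p t) t - V t) := by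
    refine ⟨hp, (measurable_profit hcm hp).sub hVm, fun t _ => hrule t, ?_, ?_⟩
    · intro t ht' s hs
      have h1 := profit_sub_profit hG hS hSc (hrule s) hs ht'
      have hst : Integrable (fun z : ℝ × R => S z.1 t - S z.1 s) (G.prod ρ) :=
        (hS'.integrable _ t).sub (hS'.integrable _ s)
      -- Pointwise, this uses that `S z.1 t - S z.1 (m z.1)` is non-negative exactly where it should
      -- be counted: mimicking `s` omits gains when `s < m z.1 ≤ t` and incurs losses when `t < m
      -- z.1 ≤ s`.
      have h2 : ∫ z in saleSet (p s), (S z.1 t - S z.1 s) ∂(G.prod ρ) + V s ≤ V t := by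
        rw [setIntegral_congr_set (hset s hs), ← integral_indicator (hTm s), hV,
          ← integral_add (hst.indicator (hTm s)) ((hdiff s).indicator (hTm s))]
        refine integral_mono ((hst.indicator (hTm s)).add ((hdiff s).indicator (hTm s)))
          ((hdiff t).indicator (hTm t)) fun z => ?_
        by_cases h3 : z ∈ {z : ℝ × R | m z.1 ≤ s}
        · by_cases h4 : z ∈ {z : ℝ × R | m z.1 ≤ t}
          · simp only [indicator_of_mem h3, indicator_of_mem h4]
            linarith
          · have := hS.monotone z.1 (not_le.1 h4).le
            simp only [indicator_of_mem h3, indicator_of_notMem h4]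
            linarith
        · have : 0 ≤ {z : ℝ × R | m z.1 ≤ t}.indicator
              (fun z => S z.1 t - S z.1 (m z.1)) z :=
            indicator_apply_nonneg fun h4 => sub_nonneg.2 (hS.monotone z.1 h4)
          simpa only [Pi.add_apply, indicator_of_notMem h3, add_zero] using this
      linarith
    · intro t ht'
      rw [sub_sub_cancel]
      exact integral_nonneg fun z => indicator_apply_nonneg fun h4 =>
        sub_nonneg.2 (hS.monotone z.1 h4)
  refine ⟨hM, ?_⟩
  rw [(hM.objective_eq hG ht hF hcm hS hSc α).2,
    ← (hS'.integral_cutoffValue (G.prod ρ) F hα hm').2.2]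
  refine integral_congr_ae ?_
  have hFI : ∀ᵐ t ∂F, t ∈ Icc t₀ t₁ := hF
  filter_upwards [hFI] with t ht'
  rw [hS'.integral_cutoff_eq (G.prod ρ) hm', sub_sub_cancel, setIntegral_congr_set (hset t ht'),
    ← integral_indicator (hTm t)]

end Mechanism

/-! ### Extension of the surplus, and prices of the two forms. -/

/-- The projection of the real line to `[a, b]`. -/
def clamp (a b x : ℝ) : ℝ := max a (min b x)

lemma clamp_mem {a b : ℝ} (hab : a ≤ b) (x : ℝ) : clamp a b x ∈ Icc a b :=
  ⟨le_max_left _ _, max_le hab (min_le_left _ _)⟩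

lemma clamp_of_mem {a b x : ℝ} (hx : x ∈ Icc a b) : clamp a b x = x := by
  rw [clamp, min_eq_right hx.2, max_eq_right hx.1]

lemma monotone_clamp (a b : ℝ) : Monotone (clamp a b) := fun _ _ h =>
  max_le_max_left _ (min_le_min_left _ h)

lemma continuous_clamp (a b : ℝ) : Continuous (clamp a b) :=
  continuous_const.max (continuous_const.min continuous_id)

section Main

variable {R : Type*} [MeasurableSpace R] {ρ : Measure R}
  {θ₀ θ₁ t₀ t₁ : ℝ} {G F : Measure ℝ}
  {c : ℝ → ℝ → ℝ} {X : ℝ → ℝ}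

/-- The total surplus, extended constantly from `[θ₀, θ₁] × [t₀, t₁]`, is a surplus family. -/
lemma exists_isSurplusFamily (hθ : θ₀ ≤ θ₁) (ht : t₀ < t₁)
    (hcm : Measurable (fun z : ℝ × ℝ => c z.1 z.2))
    (hcb : ∃ M : ℝ, ∀ θ ∈ Icc θ₀ θ₁, ∀ t ∈ Icc t₀ t₁, |c θ t| ≤ M)
    (hcc : ∀ θ ∈ Icc θ₀ θ₁, ContinuousOn (c θ) (Icc t₀ t₁))
    (hcs : ∀ θ ∈ Icc θ₀ θ₁, StrictAntiOn (c θ) (Icc t₀ t₁))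
    (hS : ∀ θ ∈ Icc θ₀ θ₁, ∀ t ∈ Icc t₀ t₁, 0 ≤ totalSurplus c θ t)
    (hX : Monotone X ∨ Antitone X) (hXi : Function.Injective X)
    (hcross : ∀ θ ∈ Icc θ₀ θ₁, ∀ θ' ∈ Icc θ₀ θ₁, X θ ≤ X θ' → ∀ s ∈ Icc t₀ t₁,
      ∀ t ∈ Icc t₀ t₁, s ≤ t →
      totalSurplus c θ t * totalSurplus c θ' s ≤ totalSurplus c θ s * totalSurplus c θ' t) :
    ∃ M, IsSurplusFamily X
      (fun θ t => totalSurplus c (clamp θ₀ θ₁ θ) (clamp t₀ t₁ t)) t₀ M := by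
  obtain ⟨M, hM⟩ := hcb
  have hθm := clamp_mem hθ
  have htm := clamp_mem ht.le
  have hanti : ∀ θ, StrictAntiOn (c (clamp θ₀ θ₁ θ)) (Icc t₀ t₁) := fun θ => hcs _ (hθm θ)
  refine ⟨θ₁ + M, ?_, fun θ t => hS _ (hθm θ) _ (htm t), fun θ t => ?_, fun θ => ?_,
    fun θ s t hst => ?_, fun θ t htt => ?_, fun θ θ' hle s t hst => ?_⟩
  · have h1 : Measurable (fun z : ℝ × ℝ => clamp θ₀ θ₁ z.1) :=
      (continuous_clamp θ₀ θ₁).measurable.comp measurable_fst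
    have h2 : Measurable (fun z : ℝ × ℝ => clamp t₀ t₁ z.2) :=
      (continuous_clamp t₀ t₁).measurable.comp measurable_snd
    exact h1.sub (hcm.comp (h1.prodMk h2))
  · have h1 := (abs_le.1 (hM _ (hθm θ) _ (htm t))).1
    have h2 := (hθm θ).2
    simp only [totalSurplus]
    linarith
  · exact continuous_const.sub
      ((hcc _ (hθm θ)).comp_continuous (continuous_clamp t₀ t₁) htm)
  · exact sub_le_sub_left ((hanti θ).antitoneOn (htm s) (htm t) (monotone_clamp t₀ t₁ hst)) _
  · have h0 := left_mem_Icc.2 ht.le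
    have hlt : t₀ < clamp t₀ t₁ t := lt_max_of_lt_right (lt_min ht htt)
    exact (hS _ (hθm θ) t₀ h0).trans_lt (sub_lt_sub_left (hanti θ h0 (htm t) hlt) _)
  · refine hcross _ (hθm θ) _ (hθm θ') ?_ _ (htm s) _ (htm t) (monotone_clamp t₀ t₁ hst)
    -- Clamping preserves the order of values; injectivity of `X` excludes the case where the
    -- ranking and the order of values disagree.
    rcases hX with hX | hX
    · rcases le_total θ θ' with h | h
      · exact hX (monotone_clamp _ _ h)
      · rw [hXi (le_antisymm hle (hX h))]
    · rcases le_total θ' θ with h | h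
      · exact hX (monotone_clamp _ _ h)
      · rw [hXi (le_antisymm hle (hX h))]

/-- If cutoffs that increase in the ranking are implemented by prices of a given form, some
mechanism of that form is optimal. -/
lemma exists_isOptimal [IsProbabilityMeasure ρ] [IsProbabilityMeasure G] [IsProbabilityMeasure F]
    (hG : G (Icc θ₀ θ₁)ᶜ = 0) (hθ : θ₀ ≤ θ₁) (ht : t₀ < t₁)
    (hF : F (Icc t₀ t₁)ᶜ = 0)
    (hcm : Measurable (fun z : ℝ × ℝ => c z.1 z.2))
    (hcb : ∃ M : ℝ, ∀ θ ∈ Icc θ₀ θ₁, ∀ t ∈ Icc t₀ t₁, |c θ t| ≤ M)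
    (hcc : ∀ θ ∈ Icc θ₀ θ₁, ContinuousOn (c θ) (Icc t₀ t₁))
    (hcs : ∀ θ ∈ Icc θ₀ θ₁, StrictAntiOn (c θ) (Icc t₀ t₁))
    (hS : ∀ θ ∈ Icc θ₀ θ₁, ∀ t ∈ Icc t₀ t₁, 0 ≤ totalSurplus c θ t)
    {α : ℝ} (hα : α ∈ Icc (0 : ℝ) 1)
    (hX : Monotone X ∨ Antitone X) (hXi : Function.Injective X)
    (hX0 : ∀ x, ∀ᵐ θ ∂G, X θ ≠ x)
    (hcross : ∀ θ ∈ Icc θ₀ θ₁, ∀ θ' ∈ Icc θ₀ θ₁, X θ ≤ X θ' → ∀ s ∈ Icc t₀ t₁,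
      ∀ t ∈ Icc t₀ t₁, s ≤ t →
      totalSurplus c θ t * totalSurplus c θ' s ≤ totalSurplus c θ s * totalSurplus c θ' t)
    {P : (ℝ → ℝ → R → ℝ) → Prop}
    (hP : ∀ m : ℝ → ℝ, Measurable m → (∀ θ θ', X θ ≤ X θ' → m θ ≤ m θ') →
      ∃ p : ℝ → ℝ → R → ℝ, Measurable (fun z : ℝ × ℝ × R => p z.1 z.2.1 z.2.2) ∧
        (∀ t θ r, θ₀ ≤ θ → θ₀ ≤ p t θ r) ∧
        (∀ t, ∀ᵐ z ∂G.prod ρ, p t z.1 z.2 ≤ z.1 ↔ m z.1 ≤ t) ∧ P p) :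
    ∃ (p : ℝ → ℝ → R → ℝ) (T : ℝ → ℝ), IsOptimal t₀ t₁ F G ρ c α p T ∧ P p := by
  obtain ⟨M, hfam⟩ := exists_isSurplusFamily hθ ht hcm hcb hcc hcs hS hX hXi hcross
  set S : ℝ → ℝ → ℝ := fun θ t => totalSurplus c (clamp θ₀ θ₁ θ) (clamp t₀ t₁ t) with hSdef
  have hSc : ∀ θ ∈ Icc θ₀ θ₁, ∀ t ∈ Icc t₀ t₁, S θ t = totalSurplus c θ t := fun θ h1 t h2 => by
    simp only [hSdef, clamp_of_mem h1, clamp_of_mem h2]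
  obtain ⟨m, -, hmX, hmax⟩ := hfam.exists_optimal_cutoff ht.le F hF hα
  have hm : Measurable m := by
    rcases hX with hX | hX
    · exact Monotone.measurable fun _ _ h => hmX _ _ (hX h)
    · exact Antitone.measurable fun _ _ h => hmX _ _ (hX h)
  have hXm : Measurable X := hX.elim Monotone.measurable Antitone.measurable
  obtain ⟨p, hp, hpθ, hpm, hPp⟩ := hP m hm hmX
  obtain ⟨T, hM, hobj⟩ := exists_tax (ρ := ρ) hG ht.le hF hcm hfam hSc hα hm hp hpθ
    fun t _ => hpm t
  refine ⟨p, T, ⟨hM, fun p' T' hM' => ?_⟩, hPp⟩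
  rw [hobj]
  rcases hX with hX | hX
  · exact hM'.objective_le hXm hX0 (fun θ hθ' => ⟨hX hθ'.1, hX hθ'.2⟩) (hX hθ) hG ht.le hF hcm
      hfam hSc hα hm hmax
  · exact hM'.objective_le hXm hX0 (fun θ hθ' => ⟨hX hθ'.2, hX hθ'.1⟩) (hX hθ) hG ht.le hF hcm
      hfam hSc hα hm hmax

/-- Cutoffs that decrease in the consumer value are implemented by uniform prices. -/
lemma exists_uniformPricing [NullSingletonClass G] (hG : G (Icc θ₀ θ₁)ᶜ = 0) (hθ : θ₀ ≤ θ₁)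
    {m : ℝ → ℝ} (hm : Antitone m) :
    ∃ p : ℝ → ℝ → R → ℝ, Measurable (fun z : ℝ × ℝ × R => p z.1 z.2.1 z.2.2) ∧
      (∀ t θ r, θ₀ ≤ θ → θ₀ ≤ p t θ r) ∧
      (∀ t, ∀ᵐ z ∂G.prod ρ, p t z.1 z.2 ≤ z.1 ↔ m z.1 ≤ t) ∧
      IsUniformPricing t₀ t₁ θ₀ θ₁ p := by
  -- The price is the infimum of the served values. Inserting `θ₁ + 1` keeps the set non-empty and
  -- gives a price without buyers when nobody is served.
  set A : ℝ → Set ℝ := fun t => insert (θ₁ + 1) {θ | θ₀ ≤ θ ∧ m θ ≤ t} with hA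
  have hlb : ∀ t, ∀ θ ∈ A t, θ₀ ≤ θ := by
    rintro t θ (rfl | h)
    · linarith
    · exact h.1
  have hne : ∀ t, (A t).Nonempty := fun t => insert_nonempty _ _
  have hbdd : ∀ t, BddBelow (A t) := fun t => ⟨θ₀, hlb t⟩
  have hk : Antitone (fun t => sInf (A t)) := fun s t hst =>
    csInf_le_csInf (hbdd t) (hne s) (insert_subset_insert fun θ h => ⟨h.1, h.2.trans hst⟩)
  refine ⟨fun t _ _ => sInf (A t), hk.measurable.comp measurable_fst,
    fun t _ _ _ => le_csInf (hne t) (hlb t), fun t => ?_, fun t _ => ⟨sInf (A t), fun _ _ _ => rfl⟩⟩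
  have hne' : ∀ᵐ θ ∂G, θ ≠ sInf (A t) := measure_eq_zero_iff_ae_notMem.1 (measure_singleton _)
  filter_upwards [ae_fst_mem (ρ := ρ) hG, Measure.quasiMeasurePreserving_fst.ae hne'] with z hz hz'
  constructor
  · intro hle
    obtain ⟨θ, h1, h2⟩ := exists_lt_of_csInf_lt (hne t) (lt_of_le_of_ne hle hz'.symm)
    rcases h1 with rfl | h1
    · linarith [hz.2]
    · exact (hm h2.le).trans h1.2
  · exact fun hle => csInf_le (hbdd t) (Or.inr ⟨hz.1, hle⟩)

/-- Any cutoffs are implemented by discriminatory prices. -/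
lemma exists_discriminatoryPricing (hG : G (Icc θ₀ θ₁)ᶜ = 0) (hθ : θ₀ ≤ θ₁)
    {m : ℝ → ℝ} (hm : Measurable m) :
    ∃ p : ℝ → ℝ → R → ℝ, Measurable (fun z : ℝ × ℝ × R => p z.1 z.2.1 z.2.2) ∧
      (∀ t θ r, θ₀ ≤ θ → θ₀ ≤ p t θ r) ∧
      (∀ t, ∀ᵐ z ∂G.prod ρ, p t z.1 z.2 ≤ z.1 ↔ m z.1 ≤ t) ∧
      IsDiscriminatoryPricing t₀ t₁ θ₀ θ₁ p := by
  refine ⟨fun t θ _ => if m θ ≤ t then θ else θ₁ + 1,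
    Measurable.ite (measurableSet_le (hm.comp measurable_snd.fst) measurable_fst)
      measurable_snd.fst measurable_const, fun t θ _ h => ?_, fun t => ?_,
    fun t _ => ⟨fun θ => if m θ ≤ t then θ else θ₁ + 1, fun θ _ => ⟨ite_eq_or_eq _ _ _,
      fun _ => rfl⟩⟩⟩
  · simp only
    split_ifs
    · exact h
    · linarith
  · filter_upwards [ae_fst_mem (ρ := ρ) hG] with z hz
    split_ifs with hc
    · simp [hc]
    · simp only [hc, iff_false, not_le]
      linarith [hz.2]

end Main

end Regulation

theorem mainTheorem11 {R : Type*} [MeasurableSpace R]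
    (ρ : Measure R) [IsProbabilityMeasure ρ]
    (θ₀ θ₁ t₀ t₁ : ℝ) (ht : t₀ < t₁)
    (G : Measure ℝ) [IsProbabilityMeasure G] [NullSingletonClass G] (hG : G (Icc θ₀ θ₁)ᶜ = 0)
    (F : Measure ℝ) [IsProbabilityMeasure F] (hF : F (Icc t₀ t₁)ᶜ = 0)
    (c : ℝ → ℝ → ℝ) (hcm : Measurable (fun z : ℝ × ℝ => c z.1 z.2))
    (hcb : ∃ M : ℝ, ∀ θ ∈ Icc θ₀ θ₁, ∀ t ∈ Icc t₀ t₁, |c θ t| ≤ M)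
    (hcd : ∀ θ ∈ Icc θ₀ θ₁, ContDiffOn ℝ 1 (c θ) (Icc t₀ t₁))
    (hcdb : ∃ M : ℝ, ∀ θ ∈ Icc θ₀ θ₁, ∀ t ∈ Icc t₀ t₁,
      |derivWithin (c θ) (Icc t₀ t₁) t| ≤ M)
    (hcs : ∀ θ ∈ Icc θ₀ θ₁, StrictAntiOn (c θ) (Icc t₀ t₁))
    (hS : ∀ θ ∈ Icc θ₀ θ₁, ∀ t ∈ Icc t₀ t₁, 0 ≤ Regulation.totalSurplus c θ t)
    (α : ℝ) (hα : α ∈ Icc (0 : ℝ) 1) :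
    (Regulation.LogSubmodularOn (Regulation.totalSurplus c) (Icc θ₀ θ₁) (Icc t₀ t₁) →
      ∃ (p : ℝ → ℝ → R → ℝ) (T : ℝ → ℝ),
        Regulation.IsOptimal t₀ t₁ F G ρ c α p T ∧
          Regulation.IsUniformPricing t₀ t₁ θ₀ θ₁ p) ∧
    (Regulation.LogSupermodularOn (Regulation.totalSurplus c) (Icc θ₀ θ₁) (Icc t₀ t₁) →
      ∃ (p : ℝ → ℝ → R → ℝ) (T : ℝ → ℝ),
        Regulation.IsOptimal t₀ t₁ F G ρ c α p T ∧
          Regulation.IsDiscriminatoryPricing t₀ t₁ θ₀ θ₁ p) := by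

  have hθ : θ₀ ≤ θ₁ := by
    by_contra! hlt
    rw [Icc_eq_empty (not_le.2 hlt), compl_empty, measure_univ] at hG
    exact one_ne_zero hG
  have hcc : ∀ θ ∈ Icc θ₀ θ₁, ContinuousOn (c θ) (Icc t₀ t₁) := fun θ h => (hcd θ h).continuousOn
  have hne : ∀ x, ∀ᵐ θ ∂G, θ ≠ x := fun x =>
    measure_eq_zero_iff_ae_notMem.1 (measure_singleton x)
  refine ⟨fun hlog => ?_, fun hlog => ?_⟩
  -- Reversing the order of values turns log-submodularity into the cross inequality.
  · refine Regulation.exists_isOptimal (X := fun θ => -θ) hG hθ ht hF hcm hcb hcc hcs hS hα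
      (Or.inr fun _ _ h => neg_le_neg h) neg_injective
      (fun x => (hne (-x)).mono fun θ h h' => h (by rw [← h', neg_neg])) ?_ ?_
    · intro θ h θ' h' hle s hs t ht' hst
      have := hlog θ' h' θ h s hs t ht' (neg_le_neg_iff.1 hle) hst
      linarith
    · exact fun m _ hmX =>
        Regulation.exists_uniformPricing hG hθ fun θ θ' h => hmX θ' θ (neg_le_neg h)
  · refine Regulation.exists_isOptimal (X := id) hG hθ ht hF hcm hcb hcc hcs hS hα
      (Or.inl monotone_id) Function.injective_id hne ?_ ?_
    · exact fun θ h θ' h' hle s hs t ht' hst => hlog θ h θ' h' s hs t ht' hle hst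
    · exact fun m hm _ => Regulation.exists_discriminatoryPricing hG hθ hm
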